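/- Let $C_m$ and $P_m$ denote the cycle and the path on $m$ vertices, and let $ex(n,H,F)$ denote the maximum number of copies of $H$ (subgraphs isomorphic to $H$, not necessarily induced) in a simple graph on $n$ vertices that contains no subgraph isomorphic to $F$. Then for all fixed integers $k \ge 1$ and $l \ge 2$, $$ex(n, P_l, C_{2k+1}) = (1+o(1)) \left(\frac{n}{2}\right)^{l} \qquad (n \to \infty).$$ -/

import Mathlib

open Filter Asymptotics

namespace SimpleGraph

open scoped Classical in
/-- The generalized Turán number `ex(n, H, F)`: the maximum number of (unlabelled, not necessarily
induced) copies of `H` in an `F`-free simple graph on `n` vertices. It is `0` by convention if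
every graph on `n` vertices contains `F`. -/
noncomputable def generalizedExtremalNumber (n : ℕ) {V W : Type*} (H : SimpleGraph V)
    (F : SimpleGraph W) : ℕ :=
  Finset.sup {G : SimpleGraph (Fin n) | F.Free G} fun G => G.copyCount H

end SimpleGraph

/-! Upper bound: in a `C_{2k+1}`-free graph no neighbourhood N(v) contains a path on 2k vertices, so
N(v) is 2k-degenerate and nearly independent. Hence the degrees over N(v) sum to at most D/2 + 2kn,
where D is the total degree (`two_mul_sum_degree_neighborFinset_le`). Cauchy–Schwarz then gives D ≤
n²/2 + 4kn, so every vertex ends at most (n/2)²(1 + 16k/n) two-step walks. Extending walks two steps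
at a time bounds their number (`sum_walksFrom_le`), and each path yields two walks.

Lower bound: count the paths alternating between the sides of a balanced complete bipartite graph.
-/

namespace SimpleGraph

/-! ### Sparse neighbourhoods -/

/-- A set in which every vertex has at least `m` neighbours spans paths of all lengths up to `m`. -/
theorem exists_isPath_of_le_card_adj {V : Type*} [DecidableEq V] (G : SimpleGraph V)
    [DecidableRel G.Adj] {S : Finset V} (hS : S.Nonempty) {m : ℕ}
    (h : ∀ a ∈ S, m ≤ (S.filter (G.Adj a)).card) :
    ∀ j ≤ m, ∃ (u w : V) (p : G.Walk u w), p.IsPath ∧ p.length = j ∧ ∀ x ∈ p.support, x ∈ S := by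
  intro j
  induction j with
  | zero =>
    intro _
    obtain ⟨a, ha⟩ := hS
    exact ⟨a, a, Walk.nil, by simp, rfl, by simpa using ha⟩
  | succ j ih =>
    intro hj
    obtain ⟨u, w, p, hp, hlen, hsupp⟩ := ih (by omega)
    -- Only j < m path vertices differ from u, so u has a neighbour in S off the path.
    have hcard : (p.support.toFinset.erase u).card < (S.filter (G.Adj u)).card := by
      have h1 : (p.support.toFinset.erase u).card + 1 = p.support.toFinset.card :=
        Finset.card_erase_add_one (by simp)
      have h2 := List.toFinset_card_le p.support
      rw [Walk.length_support] at h2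
      have := h u (hsupp u (by simp))
      omega
    obtain ⟨b, hb, hb'⟩ := Finset.exists_mem_notMem_of_card_lt_card hcard
    rw [Finset.mem_filter] at hb
    have hbp : b ∉ p.support := fun hmem => hb' (by simp [hmem, hb.2.ne'])
    refine ⟨b, w, Walk.cons hb.2.symm p, by simp [Walk.cons_isPath_iff, hp, hbp], by simp [hlen],
      ?_⟩
    intro x hx
    rw [Walk.support_cons, List.mem_cons] at hx
    rcases hx with rfl | hx
    · exact hb.1
    · exact hsupp x hx

/-- A `d`-degenerate set of vertices spans at most `d` edges per vertex. -/
theorem sum_card_adj_le_of_degenerate {V : Type*} [DecidableEq V] (G : SimpleGraph V)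
    [DecidableRel G.Adj] (d : ℕ) (S : Finset V)
    (h : ∀ S' ⊆ S, S'.Nonempty → ∃ a ∈ S', (S'.filter (G.Adj a)).card ≤ d) :
    ∑ a ∈ S, (S.filter (G.Adj a)).card ≤ 2 * d * S.card := by
  induction S using Finset.strongInduction with
  | H S ih =>
    rcases S.eq_empty_or_nonempty with rfl | hS
    · simp
    obtain ⟨a, ha, had⟩ := h S subset_rfl hS
    have hih := ih (S.erase a) (Finset.erase_ssubset ha)
      fun S' hS' => h S' (hS'.trans (Finset.erase_subset _ _))
    have hcard := Finset.card_erase_add_one ha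
    have hsplit : ∀ b, (S.filter (G.Adj b)).card =
        ((S.erase a).filter (G.Adj b)).card + if G.Adj a b then 1 else 0 := by
      intro b
      rw [Finset.card_filter, Finset.card_filter, ← Finset.sum_erase_add _ _ ha]
      simp only [G.adj_comm b a]
    have hself : ((S.erase a).filter (G.Adj a)).card = (S.filter (G.Adj a)).card := by
      simp [hsplit a]
    -- Deleting a loses its edges twice, once from each end: at most 2d.
    rw [← Finset.sum_erase_add _ _ ha, Finset.sum_congr rfl fun b _ => hsplit b,
      Finset.sum_add_distrib, ← Finset.card_filter, hself, ← hcard]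
    nlinarith

/-- In a `C_{2k+1}`-free graph every neighbourhood spans linearly many edges. -/
theorem sum_card_adj_neighborFinset_le {V : Type*} [Fintype V] [DecidableEq V]
    (G : SimpleGraph V) [DecidableRel G.Adj] {k : ℕ} (hk : 1 ≤ k)
    (hG : (cycleGraph (2 * k + 1)).Free G) (v : V) :
    ∑ a ∈ G.neighborFinset v, ((G.neighborFinset v).filter (G.Adj a)).card
      ≤ 4 * k * Fintype.card V := by
  refine (G.sum_card_adj_le_of_degenerate (2 * k) _ ?_).trans ?_
  · intro S hS hne
    by_contra! hcon
    -- A path on 2k neighbours of v closes through v into a cycle of length 2k + 1.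
    obtain ⟨u, w, p, hp, hlen, hsupp⟩ := G.exists_isPath_of_le_card_adj hne
      (fun a ha => (hcon a ha).le) (2 * k - 1) (by omega)
    have hadj : ∀ x ∈ p.support, G.Adj v x := fun x hx => by
      simpa using hS (hsupp x hx)
    have hv : v ∉ p.support := fun hv => G.irrefl (hadj v hv)
    have huw : u ≠ w := by
      rintro rfl
      rw [Walk.isPath_iff_nil, ← Walk.length_eq_zero_iff] at hp
      omega
    refine hG ((cycleGraph_isContained_iff (by omega)).2
      ⟨v, Walk.cons (hadj u (by simp)) (p.concat (hadj w (by simp)).symm), ?_, ?_⟩)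
    · rw [Walk.cons_isCycle_iff]
      refine ⟨hp.concat hv _, ?_⟩
      rw [Walk.edges_concat]
      simp only [List.concat_eq_append, List.mem_append, List.mem_singleton, not_or]
      refine ⟨fun he => hv (p.fst_mem_support_of_mem_edges he), ?_⟩
      rw [Sym2.eq_swap]
      simpa [Sym2.eq_iff, huw] using fun h : u = v => absurd (h ▸ p.start_mem_support) hv
    · simp [hlen]; omega
  · have := Finset.card_le_univ (G.neighborFinset v)
    nlinarith

/-- In a `C_{2k+1}`-free graph the degrees in a neighbourhood sum to at most about the number of
edges. -/
theorem two_mul_sum_degree_neighborFinset_le {V : Type*} [Fintype V] [DecidableEq V]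
    (G : SimpleGraph V) [DecidableRel G.Adj] {k : ℕ} (hk : 1 ≤ k)
    (hG : (cycleGraph (2 * k + 1)).Free G) (v : V) :
    2 * ∑ a ∈ G.neighborFinset v, G.degree a
      ≤ ∑ a, G.degree a + 4 * k * Fintype.card V := by
  have hT := G.sum_card_adj_neighborFinset_le hk hG v
  have hdeg : ∀ a, G.degree a = ∑ b, if G.Adj a b then 1 else 0 := by
    intro a
    rw [← Finset.card_filter, ← card_neighborFinset_eq_degree, neighborFinset_eq_filter]
  have hS : ∑ a ∈ G.neighborFinset v, G.degree a
      = ∑ a, ∑ b, if G.Adj v a ∧ G.Adj a b then 1 else 0 := by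
    rw [neighborFinset_eq_filter, Finset.sum_filter]
    refine Finset.sum_congr rfl fun a _ => ?_
    by_cases h : G.Adj v a <;> simp [h, hdeg]
  have hS' : ∑ a ∈ G.neighborFinset v, G.degree a
      = ∑ a, ∑ b, if G.Adj v b ∧ G.Adj a b then 1 else 0 := by
    rw [hS, Finset.sum_comm]
    simp_rw [G.adj_comm]
  have hT' : ∑ a ∈ G.neighborFinset v, ((G.neighborFinset v).filter (G.Adj a)).card
      = ∑ a, ∑ b, if G.Adj v a ∧ G.Adj v b ∧ G.Adj a b then 1 else 0 := by
    rw [neighborFinset_eq_filter, Finset.sum_filter]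
    refine Finset.sum_congr rfl fun a _ => ?_
    rw [Finset.filter_filter, Finset.card_filter]
    by_cases h : G.Adj v a <;> simp [h]
  -- On each ordered adjacent pair (a, b), use [a ∈ N] + [b ∈ N] ≤ 1 + [a ∈ N][b ∈ N].
  have hle : ∑ a ∈ G.neighborFinset v, G.degree a + ∑ a ∈ G.neighborFinset v, G.degree a
      ≤ ∑ a, G.degree a
        + ∑ a ∈ G.neighborFinset v, ((G.neighborFinset v).filter (G.Adj a)).card := by
    rw [hT']
    nth_rewrite 1 [hS]
    rw [hS']
    simp_rw [hdeg, ← Finset.sum_add_distrib]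
    refine Finset.sum_le_sum fun a _ => Finset.sum_le_sum fun b _ => ?_
    by_cases h1 : G.Adj v a <;> by_cases h2 : G.Adj v b <;> by_cases h3 : G.Adj a b <;>
      simp [h1, h2, h3]
  omega

/-! ### Counting walks -/

/-- The number of walks with `m` edges starting at a given vertex. -/
def walksFrom {V : Type*} [Fintype V] (G : SimpleGraph V) [DecidableRel G.Adj] : ℕ → V → ℕ
  | 0, _ => 1
  | m + 1, v => ∑ u ∈ G.neighborFinset v, G.walksFrom m u

theorem card_filter_walk_le {V : Type*} [Fintype V] [DecidableEq V]
    (G : SimpleGraph V) [DecidableRel G.Adj] (m : ℕ) (v : V) :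
    (Finset.univ.filter fun f : Fin (m + 1) → V =>
      f 0 = v ∧ ∀ i : Fin m, G.Adj (f i.castSucc) (f i.succ)).card ≤ G.walksFrom m v := by
  induction m generalizing v with
  | zero =>
    refine Finset.card_le_one.2 fun f hf g hg => ?_
    simp only [Finset.mem_filter, Finset.mem_univ, true_and] at hf hg
    funext i
    rw [Fin.fin_one_eq_zero i]
    exact hf.1.trans hg.1.symm
  | succ m ih =>
    rw [walksFrom]
    refine le_trans ?_ (Finset.sum_le_sum fun u _ => ih u)
    refine le_trans ?_ Finset.card_biUnion_le
    refine Finset.card_le_card_of_injOn Fin.tail ?_ ?_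
    · intro f hf
      simp only [Finset.coe_filter, Finset.mem_univ, true_and, Set.mem_ofPred_eq] at hf
      simp only [Finset.coe_biUnion, Set.mem_iUnion, Finset.coe_filter, Finset.mem_univ, true_and,
        Set.mem_ofPred_eq, Finset.mem_coe, mem_neighborFinset]
      refine ⟨f 1, ?_, rfl, fun i => ?_⟩
      · have := hf.2 0
        rw [Fin.castSucc_zero, hf.1] at this
        simpa using this
      · have := hf.2 i.succ
        rwa [← Fin.succ_castSucc] at this
    · intro f hf g hg hfg
      simp only [Finset.coe_filter, Finset.mem_univ, true_and, Set.mem_ofPred_eq] at hf hg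
      rw [← Fin.cons_self_tail f, ← Fin.cons_self_tail g, hfg, hf.1, hg.1]

/-- Symmetry of the adjacency matrix as a bilinear form. -/
theorem sum_neighborFinset_comm {V : Type*} [Fintype V] [DecidableEq V]
    (G : SimpleGraph V) [DecidableRel G.Adj] (f g : V → ℕ) :
    ∑ v, f v * ∑ u ∈ G.neighborFinset v, g u = ∑ u, (∑ v ∈ G.neighborFinset u, f v) * g u := by
  simp_rw [neighborFinset_eq_filter, Finset.sum_filter, Finset.mul_sum, Finset.sum_mul]
  rw [Finset.sum_comm]
  refine Finset.sum_congr rfl fun a _ => Finset.sum_congr rfl fun b _ => ?_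
  simp only [G.adj_comm b a]
  split_ifs <;> simp

theorem sum_walksFrom_one {V : Type*} [Fintype V]
    (G : SimpleGraph V) [DecidableRel G.Adj] : ∑ v, G.walksFrom 1 v = ∑ v, G.degree v := by
  simp [walksFrom]

/-- Group walks by their third vertex w. Two steps are split off because sparse neighbourhoods
control degree sums over N(w), not single degrees. -/
theorem sum_walksFrom_add_two {V : Type*} [Fintype V] [DecidableEq V]
    (G : SimpleGraph V) [DecidableRel G.Adj] (m : ℕ) :
    ∑ v, G.walksFrom (m + 2) v
      = ∑ w, (∑ u ∈ G.neighborFinset w, G.degree u) * G.walksFrom m w := by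
  have h1 := G.sum_neighborFinset_comm (fun _ => 1) (G.walksFrom (m + 1))
  have h2 := G.sum_neighborFinset_comm (fun v => G.degree v) (G.walksFrom m)
  simp only [one_mul, Finset.sum_const, card_neighborFinset_eq_degree, smul_eq_mul, mul_one] at h1
  rw [← h2]
  exact h1

/-! ### Labelled and unlabelled paths -/

theorem labelledCopyCount_eq_card {V W : Type*} [Fintype V] [Fintype W] (G : SimpleGraph V)
    (H : SimpleGraph W) [Fintype (Copy H G)] :
    G.labelledCopyCount H = (Finset.univ : Finset (Copy H G)).card := by
  rw [labelledCopyCount, Finset.card_univ]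
  exact @Fintype.card_congr _ _ (_) (_) (Equiv.refl _)

/-- Labelled copies of a path are walks. -/
theorem labelledCopyCount_pathGraph_le {V : Type*} [Fintype V] [DecidableEq V]
    (G : SimpleGraph V) [DecidableRel G.Adj] (m : ℕ) :
    G.labelledCopyCount (pathGraph (m + 1)) ≤ ∑ v, G.walksFrom m v := by
  classical
  rw [labelledCopyCount_eq_card]
  refine le_trans ?_ (Finset.sum_le_sum fun v _ => G.card_filter_walk_le m v)
  refine le_trans ?_ Finset.card_biUnion_le
  refine Finset.card_le_card_of_injOn (fun f => ⇑f) (fun f _ => ?_)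
    DFunLike.coe_injective.injOn
  simp only [Finset.mem_coe, Finset.mem_biUnion, Finset.mem_filter, Finset.mem_univ, true_and]
  refine ⟨f 0, rfl, fun i => f.toHom.map_adj ?_⟩
  rw [pathGraph_adj]
  left
  simp

/-- The reversal of a path graph. -/
def pathGraphRev (l : ℕ) : Copy (pathGraph l) (pathGraph l) where
  toHom := ⟨Fin.rev, fun {a b} h => by
    rw [pathGraph_adj] at h ⊢
    simp only [Fin.val_rev]
    omega⟩
  injective' := Fin.rev_injective

@[simp] theorem pathGraphRev_apply (l : ℕ) (i : Fin l) : pathGraphRev l i = i.rev := rfl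

theorem toSubgraph_comp_pathGraphRev {V : Type*} {G : SimpleGraph V} {l : ℕ}
    (f : Copy (pathGraph l) G) : (f.comp (pathGraphRev l)).toSubgraph = f.toSubgraph := by
  have hadj : ∀ a b : Fin l, (pathGraph l).Adj a.rev b.rev ↔ (pathGraph l).Adj a b := by
    intro a b
    simp only [pathGraph_adj, Fin.val_rev]
    omega
  ext a b
  · simp only [Subgraph.map_verts, Subgraph.verts_top, Set.image_univ, Copy.coe_toHom,
      Copy.coe_comp, Set.mem_range, Function.comp_apply, pathGraphRev_apply]
    exact ⟨fun ⟨i, hi⟩ => ⟨_, hi⟩, fun ⟨i, hi⟩ => ⟨i.rev, by simpa using hi⟩⟩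
  · simp only [Subgraph.map_adj, Relation.Map, Subgraph.top_adj, Copy.toHom_apply,
      Copy.comp_apply, pathGraphRev_apply]
    constructor
    · rintro ⟨i, j, h, rfl, rfl⟩
      exact ⟨_, _, (hadj i j).2 h, rfl, rfl⟩
    · rintro ⟨i, j, h, rfl, rfl⟩
      exact ⟨i.rev, j.rev, (hadj i j).2 h, by simp, by simp⟩

/-- Every unlabelled path on at least two vertices has two labellings. -/
theorem two_mul_copyCount_pathGraph_le {V : Type*} [Fintype V]
    (G : SimpleGraph V) {l : ℕ} (hl : 2 ≤ l) :
    2 * G.copyCount (pathGraph l) ≤ G.labelledCopyCount (pathGraph l) := by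
  classical
  rw [copyCount_eq_card_image_copyToSubgraph, labelledCopyCount_eq_card]
  refine Finset.mul_card_image_le_card _ _ fun S hS => ?_
  obtain ⟨f, -, rfl⟩ := Finset.mem_image.1 hS
  have hne : f ≠ f.comp (pathGraphRev l) := by
    intro h
    have h0 := f.injective (show f ⟨0, by omega⟩ = f (Fin.rev ⟨0, by omega⟩) from
      DFunLike.congr_fun h _)
    have := congrArg Fin.val h0
    simp only [Fin.val_rev] at this
    omega
  rw [← Finset.card_pair hne]
  refine Finset.card_le_card fun g hg => ?_
  rw [Finset.mem_insert, Finset.mem_singleton] at hg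
  rcases hg with rfl | rfl
  · simp
  · simp [toSubgraph_comp_pathGraphRev]

/-- An injective endomorphism of a path is the identity or the reversal. -/
theorem pathGraph_copy_eq {l : ℕ} (σ : Copy (pathGraph l) (pathGraph l)) :
    (∀ i, σ i = i) ∨ ∀ i, σ i = i.rev := by
  rcases Nat.lt_or_ge l 2 with hl | hl
  · left
    intro i
    have := (σ i).isLt
    apply Fin.ext
    omega
  have hadj : ∀ i (h : i + 1 < l), (σ ⟨i, by omega⟩ : ℕ) + 1 = σ ⟨i + 1, h⟩ ∨
      (σ ⟨i + 1, h⟩ : ℕ) + 1 = σ ⟨i, by omega⟩ := fun i h =>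
    pathGraph_adj.1 (σ.toHom.map_adj (pathGraph_adj.2 (Or.inl rfl)))
  -- Injectivity forbids turning back, so the first step fixes the direction of all the others.
  have hinj : ∀ i (h : i + 2 < l), (σ ⟨i, by omega⟩ : ℕ) ≠ σ ⟨i + 2, h⟩ := by
    intro i h he
    have := congrArg Fin.val (σ.injective (Fin.ext he))
    simp at this
  have hlast := (σ ⟨l - 1, by omega⟩).isLt
  have hfirst := (σ ⟨0, by omega⟩).isLt
  rcases hadj 0 (by omega) with h0 | h0
  · left
    have hup : ∀ i (h : i + 1 < l), (σ ⟨i, by omega⟩ : ℕ) + 1 = σ ⟨i + 1, h⟩ := by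
      intro i
      induction i with
      | zero => exact fun _ => h0
      | succ i ih =>
        intro h
        have h1 := ih (by omega)
        have h2 := hadj (i + 1) h
        have h3 : _ ≠ (σ ⟨i + 1 + 1, h⟩ : ℕ) := hinj i h
        omega
    have hval : ∀ i (h : i < l), (σ ⟨i, h⟩ : ℕ) = σ ⟨0, by omega⟩ + i := by
      intro i
      induction i with
      | zero => exact fun _ => rfl
      | succ i ih =>
        intro h
        rw [← hup i h, ih (by omega)]
        omega
    -- Climbing l - 1 steps inside `Fin l` forces the start to be 0.
    have := hval (l - 1) (by omega)
    intro i
    apply Fin.ext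
    have := hval i i.isLt
    simp only [Fin.eta] at this
    omega
  · right
    have hdown : ∀ i (h : i + 1 < l), (σ ⟨i + 1, h⟩ : ℕ) + 1 = σ ⟨i, by omega⟩ := by
      intro i
      induction i with
      | zero => exact fun _ => h0
      | succ i ih =>
        intro h
        have h1 := ih (by omega)
        have h2 := hadj (i + 1) h
        have h3 : _ ≠ (σ ⟨i + 1 + 1, h⟩ : ℕ) := hinj i h
        omega
    have hval : ∀ i (h : i < l), (σ ⟨i, h⟩ : ℕ) + i = σ ⟨0, by omega⟩ := by
      intro i
      induction i with
      | zero => exact fun _ => rfl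
      | succ i ih =>
        intro h
        rw [← ih (by omega), ← hdown i h]
        omega
    have := hval (l - 1) (by omega)
    intro i
    apply Fin.ext
    have := hval i i.isLt
    simp only [Fin.eta] at this
    rw [Fin.val_rev]
    omega

/-- Every unlabelled path has at most two labellings. -/
theorem labelledCopyCount_pathGraph_le_two_mul {V : Type*} [Fintype V]
    (G : SimpleGraph V) (l : ℕ) :
    G.labelledCopyCount (pathGraph l) ≤ 2 * G.copyCount (pathGraph l) := by
  classical
  rw [copyCount_eq_card_image_copyToSubgraph, labelledCopyCount_eq_card]
  refine Finset.card_le_mul_card_image _ _ fun S hS => ?_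
  obtain ⟨f, -, rfl⟩ := Finset.mem_image.1 hS
  refine le_trans (Finset.card_le_card (t := {f, f.comp (pathGraphRev l)}) fun g hg => ?_)
    Finset.card_le_two
  have hgf : g.toSubgraph = f.toSubgraph := by simpa using hg
  have hverts : ∀ i, ∃ j, f j = g i := by
    intro i
    have : g i ∈ g.toSubgraph.verts := by simp
    rw [hgf] at this
    simpa using this
  choose τ hτ using hverts
  -- Copies with the same image differ by an injective endomorphism of the path.
  let σ : Copy (pathGraph l) (pathGraph l) :=
    ⟨⟨τ, fun {a b} hab => by
      have h : g.toSubgraph.Adj (g a) (g b) := ⟨a, b, hab, rfl, rfl⟩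
      rw [hgf] at h
      obtain ⟨i, j, hij, hi, hj⟩ := h
      have hi' : i = τ a := f.injective (hi.trans (hτ a).symm)
      have hj' : j = τ b := f.injective (hj.trans (hτ b).symm)
      rw [← hi', ← hj']
      exact hij⟩, fun a b hab => g.injective (by
        change g a = g b
        rw [← hτ a, ← hτ b]
        exact congrArg f hab)⟩
  rw [Finset.mem_insert, Finset.mem_singleton]
  rcases pathGraph_copy_eq σ with h | h
  · left
    ext i
    rw [← hτ i, show τ i = i from h i]
  · right
    ext i
    rw [← hτ i, show τ i = i.rev from h i]
    simp

/-! ### Bipartite construction -/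

/-- The balanced complete bipartite graph on `Fin n` whose parts are the parity classes. -/
def parityGraph (n : ℕ) : SimpleGraph (Fin n) where
  Adj i j := (i : ℕ) % 2 ≠ (j : ℕ) % 2
  symm := ⟨fun _ _ h => h.symm⟩
  loopless := ⟨fun _ h => h rfl⟩

theorem cycleGraph_odd_free_parityGraph {k : ℕ} (hk : 1 ≤ k) (n : ℕ) :
    (cycleGraph (2 * k + 1)).Free (parityGraph n) := by
  rintro ⟨f⟩
  have hcol : (parityGraph n).Colorable 2 :=
    ⟨Coloring.mk (fun i => ⟨(i : ℕ) % 2, by omega⟩) fun {a b} h he => h (congrArg Fin.val he)⟩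
  have h := (hcol.of_hom f.toHom).chromaticNumber_le
  rw [chromaticNumber_cycleGraph_of_odd _ (by omega) ⟨k, rfl⟩] at h
  exact absurd h (by decide)

/-- The labelled path in the parity graph with prescribed start parity and prescribed positions in
each parity class. -/
def parityGraphCopy (n l : ℕ) (x : Fin 2 × (Fin l ↪ Fin (n / 2))) :
    Copy (pathGraph l) (parityGraph n) where
  toHom :=
    -- Position p < n / 2 in the class of parity r is the vertex 2p + r < n; parities alternate
    -- along the path.
    { toFun := fun i => ⟨2 * (x.2 i : ℕ) + (x.1 + i) % 2, by have := (x.2 i).isLt; omega⟩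
      map_rel' := fun {a b} h => by
        rw [pathGraph_adj] at h
        simp only [parityGraph]
        omega }
  injective' := fun a b h => by
    have := congrArg Fin.val h
    simp only [RelHom.coeFn_mk] at this
    exact x.2.injective (Fin.ext (by omega))

theorem parityGraphCopy_injective (n : ℕ) {l : ℕ} (hl : 1 ≤ l) :
    Function.Injective (parityGraphCopy n l) := by
  intro x y h
  have hval : ∀ i, 2 * (x.2 i : ℕ) + (x.1 + i) % 2 = 2 * (y.2 i : ℕ) + (y.1 + i) % 2 :=
    fun i => congrArg Fin.val (DFunLike.congr_fun h i)
  refine Prod.ext (Fin.ext ?_) (DFunLike.ext _ _ fun i => Fin.ext ?_)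
  · have := hval ⟨0, hl⟩
    simp only [add_zero] at this
    omega
  · have := hval i
    omega

theorem descFactorial_le_copyCount_parityGraph (n : ℕ) {l : ℕ} (hl : 1 ≤ l) :
    (n / 2).descFactorial l ≤ (parityGraph n).copyCount (pathGraph l) := by
  classical
  have h := Fintype.card_le_of_injective _ (parityGraphCopy_injective n hl)
  rw [Fintype.card_prod, Fintype.card_embedding_eq, Fintype.card_fin, Fintype.card_fin,
    Fintype.card_fin] at h
  have h' : 2 * (n / 2).descFactorial l ≤ (parityGraph n).labelledCopyCount (pathGraph l) := by
    rw [labelledCopyCount_eq_card]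
    exact h
  have := (parityGraph n).labelledCopyCount_pathGraph_le_two_mul l
  omega

/-! ### Upper bound -/

/-- Quantitative upper bound for the number of paths in a `C_{2k+1}`-free graph. -/
theorem sum_walksFrom_le {V : Type*} [Fintype V] [DecidableEq V]
    (G : SimpleGraph V) [DecidableRel G.Adj] {k : ℕ} (hk : 1 ≤ k)
    (hG : (cycleGraph (2 * k + 1)).Free G) {n : ℝ} (hn : 0 < n) (hcard : (Fintype.card V : ℝ) = n)
    (m : ℕ) :
    ((∑ v, G.walksFrom m v : ℕ) : ℝ) ≤ 2 * (n / 2) ^ (m + 1) * (1 + 16 * k / n) ^ m := by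
  have hk' : (1 : ℝ) ≤ k := by exact_mod_cast hk
  have hs : ∀ v, (∑ a ∈ G.neighborFinset v, G.degree a : ℝ)
      ≤ ((∑ a, G.degree a : ℕ) + 4 * k * n) / 2 := by
    intro v
    have h : (2 * ∑ a ∈ G.neighborFinset v, G.degree a : ℝ)
        ≤ (∑ a, G.degree a : ℕ) + 4 * k * (Fintype.card V : ℝ) := by
      exact_mod_cast G.two_mul_sum_degree_neighborFinset_le hk hG v
    rw [hcard] at h
    push_cast at h ⊢
    linarith
  -- Cauchy–Schwarz, with the sum of squared degrees rewritten as the sum over v of the degrees in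
  -- N(v).
  have hsq : ((∑ a, G.degree a : ℕ) : ℝ) ^ 2
      ≤ n * (n * (((∑ a, G.degree a : ℕ) + 4 * k * n) / 2)) := by
    have h1 := sq_sum_le_card_mul_sum_sq (s := Finset.univ) (f := fun v => (G.degree v : ℝ))
    have h2 : (∑ v, (G.degree v : ℝ) ^ 2) = ∑ v, ∑ a ∈ G.neighborFinset v, (G.degree a : ℝ) := by
      have := G.sum_neighborFinset_comm (fun _ => 1) (fun v => G.degree v)
      simp only [one_mul, Finset.sum_const, card_neighborFinset_eq_degree, smul_eq_mul,
        mul_one] at this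
      simp_rw [sq]
      exact_mod_cast this.symm
    have h3 := Finset.sum_le_sum fun v (_ : v ∈ Finset.univ) => hs v
    rw [Finset.sum_const, Finset.card_univ, nsmul_eq_mul, hcard] at h3
    rw [Finset.card_univ, hcard, h2] at h1
    push_cast at h1 h3 ⊢
    exact h1.trans (mul_le_mul_of_nonneg_left h3 hn.le)
  set D : ℝ := ((∑ a, G.degree a : ℕ) : ℝ) with hD
  -- Otherwise D(D - n²/2) > 2kn³, against `hsq`.
  have hDle : D ≤ n ^ 2 / 2 + 4 * k * n := by
    by_contra! hcon
    have hkn : 0 < 4 * k * n := by positivity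
    have hn2 : 0 < n ^ 2 := by positivity
    nlinarith [mul_lt_mul_of_pos_left hcon hkn, mul_lt_mul_of_pos_left hcon hn2]
  -- The right side is the bound D/2 + 2kn after inserting `hDle`.
  have hfac : (n / 2) ^ 2 * (1 + 16 * k / n) = n ^ 2 / 4 + 4 * k * n := by
    field_simp
    ring
  have hone : 1 ≤ 1 + 16 * k / n := by
    have : 0 ≤ 16 * k / n := by positivity
    linarith
  induction m using Nat.twoStepInduction with
  | zero =>
    simp only [walksFrom, Finset.sum_const, Finset.card_univ, smul_eq_mul, mul_one, hcard]
    linarith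
  | one =>
    rw [sum_walksFrom_one, ← hD, show (2 : ℝ) * (n / 2) ^ (1 + 1) * (1 + 16 * k / n) ^ 1
      = 2 * ((n / 2) ^ 2 * (1 + 16 * k / n)) by ring, hfac]
    have : 0 < 4 * k * n := by positivity
    linarith
  | more m ih _ =>
    rw [sum_walksFrom_add_two]
    calc ((∑ w, (∑ u ∈ G.neighborFinset w, G.degree u) * G.walksFrom m w : ℕ) : ℝ)
        ≤ ∑ w, (n / 2) ^ 2 * (1 + 16 * k / n) * G.walksFrom m w := by
          push_cast
          refine Finset.sum_le_sum fun w _ => mul_le_mul_of_nonneg_right ?_ (by positivity)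
          rw [hfac]
          have := hs w
          linarith
      _ = (n / 2) ^ 2 * (1 + 16 * k / n) * (∑ w, G.walksFrom m w : ℕ) := by
          rw [← Finset.mul_sum]
          push_cast
          rfl
      _ ≤ (n / 2) ^ 2 * (1 + 16 * k / n) * (2 * (n / 2) ^ (m + 1) * (1 + 16 * k / n) ^ m) :=
          mul_le_mul_of_nonneg_left ih (by positivity)
      _ = 2 * (n / 2) ^ (m + 2 + 1) * (1 + 16 * k / n) ^ (m + 1) := by ring
      _ ≤ _ := by
          refine mul_le_mul_of_nonneg_left ?_ (by positivity)
          exact pow_le_pow_right₀ hone (by omega)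

theorem generalizedExtremalNumber_path_oddCycle_le {k l n : ℕ} (hk : 1 ≤ k) (hl : 2 ≤ l)
    (hn : 0 < n) :
    (generalizedExtremalNumber n (pathGraph l) (cycleGraph (2 * k + 1)) : ℝ)
      ≤ ((n : ℝ) / 2) ^ l * (1 + 16 * k / n) ^ (l - 1) := by
  classical
  obtain ⟨m, rfl⟩ : ∃ m, l = m + 1 := ⟨l - 1, by omega⟩
  have hn' : (0 : ℝ) < n := by exact_mod_cast hn
  -- The supremum is taken in ℕ, so the real bound enters through its floor.
  have hfloor := Nat.floor_le (a := ((n : ℝ) / 2) ^ (m + 1) * (1 + 16 * k / n) ^ m) (by positivity)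
  refine le_trans (Nat.cast_le.2 ?_) hfloor
  unfold generalizedExtremalNumber
  refine Finset.sup_le fun G hG => Nat.le_floor ?_
  have hfree : (cycleGraph (2 * k + 1)).Free G := by simpa using hG
  have h1 := (G.two_mul_copyCount_pathGraph_le hl).trans (G.labelledCopyCount_pathGraph_le m)
  have h2 := G.sum_walksFrom_le hk hfree hn' (by simp) m
  have h3 : (2 * G.copyCount (pathGraph (m + 1)) : ℝ) ≤ (∑ v, G.walksFrom m v : ℕ) := by
    exact_mod_cast h1
  linarith

theorem descFactorial_le_generalizedExtremalNumber {k l : ℕ} (hk : 1 ≤ k) (hl : 1 ≤ l) (n : ℕ) :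
    (n / 2).descFactorial l
      ≤ generalizedExtremalNumber n (pathGraph l) (cycleGraph (2 * k + 1)) := by
  refine (descFactorial_le_copyCount_parityGraph n hl).trans ?_
  exact Finset.le_sup (f := fun G : SimpleGraph (Fin n) => G.copyCount (pathGraph l))
    (by simpa using cycleGraph_odd_free_parityGraph hk n)

end SimpleGraph

/-! ### Asymptotics -/

theorem theorem2p13 (k l : ℕ) (hk : 1 ≤ k) (hl : 2 ≤ l) :
    (fun n : ℕ => (SimpleGraph.generalizedExtremalNumber n (SimpleGraph.pathGraph l)
        (SimpleGraph.cycleGraph (2 * k + 1)) : ℝ))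
      ~[atTop] fun n : ℕ => ((n : ℝ) / 2) ^ l := by
  have hpos : ∀ n : ℕ, 0 < n → (0 : ℝ) < ((n : ℝ) / 2) ^ l := fun n hn => by
    have : (0 : ℝ) < n := by exact_mod_cast hn
    positivity
  refine (isEquivalent_iff_tendsto_one ?_).2 ?_
  · filter_upwards [eventually_gt_atTop 0] with n hn using (hpos n hn).ne'
  have hlim : ∀ (c : ℝ) (j : ℕ), Tendsto (fun n : ℕ => (1 + c / (n : ℝ)) ^ j) atTop (nhds 1) := by
    intro c j
    have := ((tendsto_const_div_atTop_nhds_zero_nat c).const_add 1).pow j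
    simpa using this
  refine tendsto_of_tendsto_of_tendsto_of_le_of_le' (hlim (-(2 * l)) l) (hlim (16 * k) (l - 1))
    ?_ ?_
  -- For n ≥ 2l the base 1 - 2l/n is nonnegative, so taking powers is monotone.
  · filter_upwards [eventually_ge_atTop (2 * l)] with n hn
    have hn0 : 0 < n := by omega
    have hn' : (0 : ℝ) < n := by exact_mod_cast hn0
    have hnl : (2 * l : ℝ) ≤ n := by exact_mod_cast hn
    rw [Pi.div_apply, le_div_iff₀ (hpos n hn0), ← mul_pow]
    have h1 : ((n / 2 + 1 - l : ℕ) : ℝ) ^ l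
        ≤ SimpleGraph.generalizedExtremalNumber n (SimpleGraph.pathGraph l)
          (SimpleGraph.cycleGraph (2 * k + 1)) := by
      exact_mod_cast (Nat.pow_sub_le_descFactorial _ _).trans
        (SimpleGraph.descFactorial_le_generalizedExtremalNumber (l := l) hk (by omega) n)
    refine le_trans ?_ h1
    have h2 : (1 + -(2 * l) / (n : ℝ)) * (n / 2) = n / 2 - l := by
      field_simp
      ring
    rw [h2]
    refine pow_le_pow_left₀ (by linarith) ?_ _
    have h3 : (n : ℝ) ≤ 2 * ((n / 2 + 1 - l : ℕ) : ℝ) + 2 * l := by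
      exact_mod_cast (show n ≤ 2 * (n / 2 + 1 - l) + 2 * l by omega)
    linarith
  · filter_upwards [eventually_gt_atTop 0] with n hn
    have h := SimpleGraph.generalizedExtremalNumber_path_oddCycle_le hk hl hn
    rw [Pi.div_apply, div_le_iff₀ (hpos n hn)]
    exact h.trans_eq (mul_comm _ _)
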